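/- For positive integers $n$, write $M_n = M_n(\mathbb{C})$. An \emph{operator system} in $M_n$ is a complex linear subspace $\mathcal V \subseteq M_n$ such that $I_n \in \mathcal V$ and $A^* \in \mathcal V$ for every $A \in \mathcal V$. A \emph{$k$-anticlique} of $\mathcal V$ is an orthogonal projection $P \in M_n$ of rank $k$ such that $P \mathcal V P = \mathrm{span}\{P\}$. For positive integers $m < n$, the \emph{lower quantum Turán number} $T^\downarrow(n,m)$ is the smallest integer $d$ such that there exists an operator system $\mathcal V \subseteq M_n$ with $\dim_{\mathbb{C}} \mathcal V = d$ that has no $(m+1)$-anticlique. Theorem. Let $n$ and $m$ be positive integers with $3m < n \leq 4m$. Then $T^\downarrow(n,m) = 4$. Equivalently, there is an operator system in $M_n$ of dimension $4$ with no $(m+1)$-anticlique, and every operator system in $M_n$ with no $(m+1)$-anticlique has dimension at least $4$. In particular, $T^\downarrow(4,1) = 4$. -/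

import Mathlib

open scoped Matrix

/-- A quantum graph on `M_n`, i.e. an operator system in `M_n(ℂ)`: a complex linear subspace
that contains the identity matrix and is closed under the adjoint. -/
structure IsOperatorSystem {n : ℕ} (V : Submodule ℂ (Matrix (Fin n) (Fin n) ℂ)) : Prop where
  one_mem : (1 : Matrix (Fin n) (Fin n) ℂ) ∈ V
  conjTranspose_mem : ∀ A ∈ V, Aᴴ ∈ V

/-- `P` is a `k`-anticlique of `V`: an orthogonal projection of rank `k` such that
`P V P = span {P}`. -/
structure IsAnticlique {n : ℕ} (V : Submodule ℂ (Matrix (Fin n) (Fin n) ℂ)) (k : ℕ)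
    (P : Matrix (Fin n) (Fin n) ℂ) : Prop where
  isHermitian : P.IsHermitian
  idempotent : P * P = P
  rank_eq : P.rank = k
  compression_eq :
    (fun A => P * A * P) '' (V : Set (Matrix (Fin n) (Fin n) ℂ)) =
      (Submodule.span ℂ {P} : Set (Matrix (Fin n) (Fin n) ℂ))

/-- The set of dimensions of operator systems in `M_n` that have no `(m+1)`-anticlique. -/
def lowerTuranDims (n m : ℕ) : Set ℕ :=
  {d | ∃ V : Submodule ℂ (Matrix (Fin n) (Fin n) ℂ),
    IsOperatorSystem V ∧ Module.finrank ℂ V = d ∧ ¬ ∃ P, IsAnticlique V (m + 1) P}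

/-- The lower quantum Turán number `T^↓(n,m)`: the smallest dimension of an operator system
in `M_n` with no `(m+1)`-anticlique. -/
noncomputable def lowerQuantumTuran (n m : ℕ) : ℕ :=
  sInf (lowerTuranDims n m)

/-! Upper bound: split the identity of `M_n` into four diagonal projections of rank at most `m`. If
`P` has rank `m + 1` and compresses each of them to a multiple of `P`, every multiple is zero for
rank reasons, and summing gives `P = 0`.

Lower bound: an operator system of dimension at most 3 lies in the span of `1`, `T`, `Tᴴ`, so an
anticlique is a subspace of dimension `m + 1` on which the quadratic form of `T` is a constant `c`
times the squared norm. Such a `c` and subspace exist once `n > 3m`. Helly's theorem in the plane,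
applied to the numerical ranges of `T` on subspaces of codimension at most `m`, gives a `c` such
that every rotation of `T - c` has nonnegative real part on some subspace of dimension `m + 1`
(`exists_weakDim_sub_smul_one`). This condition yields an isotropic subspace of that dimension
(`WeakDim.exists_isotropicOn`), by induction on the dimension: a degenerate vector is split off at
the cost of one dimension (`WeakDim.inf`). Such a vector exists if the condition holds but is not
strict, or if it is strict and the ambient dimension is at most twice the target. The remaining
strict case reduces to these by real shifts of `T`. -/

section NumericalRange

open Module Filter Topology ComplexConjugate

variable {V : Type*} [NormedAddCommGroup V] [InnerProductSpace ℂ V]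

/-! ### Positive and nonnegative subspaces of the real part of a form. -/

/-- Some `k`-dimensional subspace of `U` carries a nonnegative compression of the real
part of `T`. -/
def NonnegDim (U : Submodule ℂ V) (k : ℕ) (T : V →L[ℂ] V) : Prop :=
  ∃ W ≤ U, k ≤ finrank ℂ W ∧ ∀ x ∈ W, 0 ≤ (inner ℂ x (T x)).re

/-- Some `k`-dimensional subspace of `U` carries a positive definite compression of the real
part of `T`. -/
def PosDim (U : Submodule ℂ V) (k : ℕ) (T : V →L[ℂ] V) : Prop :=
  ∃ W ≤ U, k ≤ finrank ℂ W ∧ ∀ x ∈ W, x ≠ 0 → 0 < (inner ℂ x (T x)).re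

theorem PosDim.nonnegDim {U : Submodule ℂ V} {k : ℕ} {T : V →L[ℂ] V} (h : PosDim U k T) :
    NonnegDim U k T := by
  obtain ⟨W, hWU, hW, h⟩ := h
  refine ⟨W, hWU, hW, fun x hx => ?_⟩
  rcases eq_or_ne x 0 with rfl | h0
  · simp
  · exact (h x hx h0).le

theorem abs_re_inner_sub_le (T S : V →L[ℂ] V) (x : V) :
    |(inner ℂ x (T x)).re - (inner ℂ x (S x)).re| ≤ dist T S * ‖x‖ ^ 2 := by
  rw [← Complex.sub_re, ← inner_sub_right, ← _root_.sub_apply, dist_eq_norm]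
  refine (Complex.abs_re_le_norm _).trans ((norm_inner_le_norm _ _).trans ?_)
  calc ‖x‖ * ‖(T - S) x‖ ≤ ‖x‖ * (‖T - S‖ * ‖x‖) := by
        gcongr; exact (T - S).le_opNorm x
    _ = _ := by ring

theorem OrthonormalBasis.finrank_span_subtype {ι : Type*} [Fintype ι]
    (b : OrthonormalBasis ι ℂ V) (p : ι → Prop) [DecidablePred p] :
    finrank ℂ (Submodule.span ℂ (Set.range fun i : {i // p i} => b i)) =
      Fintype.card {i // p i} := by
  have h : LinearIndependent ℂ fun i : {i // p i} => b i :=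
    b.orthonormal.linearIndependent.comp (fun i : {i // p i} => (i : ι)) Subtype.val_injective
  exact finrank_span_eq_card h

variable [FiniteDimensional ℂ V]

theorem Submodule.exists_mem_inf_ne_zero {U W F : Submodule ℂ V} (hW : W ≤ U) (hF : F ≤ U)
    (h : finrank ℂ U < finrank ℂ W + finrank ℂ F) : ∃ x ∈ W, x ∈ F ∧ x ≠ 0 := by
  have h1 := Submodule.finrank_sup_add_finrank_inf_eq W F
  have h2 := Submodule.finrank_mono (sup_le hW hF)
  have h3 : W ⊓ F ≠ ⊥ := by
    intro h0
    rw [h0, finrank_bot] at h1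
    omega
  obtain ⟨x, hx, hx0⟩ := Submodule.exists_mem_ne_zero_of_ne_bot h3
  exact ⟨x, hx.1, hx.2, hx0⟩

theorem Submodule.finrank_le_finrank_inf_ker_add_one (W : Submodule ℂ V) (l : V →ₗ[ℂ] ℂ) :
    finrank ℂ W ≤ finrank ℂ (W ⊓ LinearMap.ker l : Submodule ℂ V) + 1 := by
  have h1 := Submodule.finrank_sup_add_finrank_inf_eq W (LinearMap.ker l)
  have h2 := LinearMap.finrank_range_add_finrank_ker l
  have h3 : finrank ℂ (LinearMap.range l) ≤ 1 := by
    simpa using Submodule.finrank_le (LinearMap.range l)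
  have h4 := Submodule.finrank_le (W ⊔ LinearMap.ker l)
  omega

/-- The compression of an operator to a subspace. -/
noncomputable def compression (U : Submodule ℂ V) (T : V →L[ℂ] V) : U →ₗ[ℂ] U :=
  (U.orthogonalProjectionOnto : V →ₗ[ℂ] U) ∘ₗ (T : V →ₗ[ℂ] V) ∘ₗ U.subtype

theorem inner_compression_right (U : Submodule ℂ V) (T : V →L[ℂ] V) (x y : U) :
    inner ℂ x (compression U T y) = inner ℂ (x : V) (T y) := by
  simp [compression]

theorem inner_compression_left (U : Submodule ℂ V) (T : V →L[ℂ] V) (x y : U) :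
    inner ℂ (compression U T x) y = inner ℂ (T x) (y : V) := by
  simp [compression]

/-- Diagonalise the Hermitian operator `C + C*`, where `C` compresses `T` to `U`, and separate
positive eigenvalues from the others. A vector of the nonpositive part with value zero has only null
components, so it lies in the kernel; this is the last clause. -/
theorem exists_pos_nonpos_split (U : Submodule ℂ V) (T : V →L[ℂ] V) :
    ∃ W ≤ U, ∃ F ≤ U, finrank ℂ W + finrank ℂ F = finrank ℂ U ∧
      (∀ x ∈ W, x ≠ 0 → 0 < (inner ℂ x (T x)).re) ∧
      (∀ x ∈ F, (inner ℂ x (T x)).re ≤ 0) ∧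
      (∀ x ∈ F, (inner ℂ x (T x)).re = 0 → ∀ y ∈ U, inner ℂ x (T y) + inner ℂ (T x) y = 0) := by
  set C := compression U T
  set H : U →ₗ[ℂ] U := C + LinearMap.adjoint C with hH
  have hs : H.IsSymmetric := by
    intro x y
    simp [hH, inner_add_left, inner_add_right, LinearMap.adjoint_inner_left,
      LinearMap.adjoint_inner_right, add_comm]
  obtain ⟨b, e, hbe⟩ : ∃ (b : OrthonormalBasis (Fin (finrank ℂ U)) ℂ U)
      (e : Fin (finrank ℂ U) → ℝ), ∀ i, H (b i) = (e i : ℂ) • b i :=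
    ⟨hs.eigenvectorBasis rfl, hs.eigenvalues rfl, fun i => hs.apply_eigenvectorBasis rfl i⟩
  have hHx : ∀ x : U, (inner ℂ x (H x)).re = 2 * (inner ℂ (x : V) (T x)).re := by
    intro x
    rw [hH, LinearMap.add_apply, inner_add_right, LinearMap.adjoint_inner_right,
      inner_compression_right, inner_compression_left, ← inner_conj_symm (T (x : V)) (x : V)]
    simp only [Complex.add_re, Complex.conj_re]
    ring
  have hexp : ∀ x : U, (inner ℂ x (H x)).re = ∑ i, e i * ‖inner ℂ (b i) x‖ ^ 2 := by
    intro x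
    rw [← b.sum_inner_mul_inner x (H x), Complex.re_sum]
    refine Finset.sum_congr rfl fun i _ => ?_
    have h1 : inner ℂ (b i) (H x) = (e i : ℂ) * inner ℂ (b i) x := by
      rw [← hs (b i) x, hbe, inner_smul_left, Complex.conj_ofReal]
    rw [h1, ← inner_conj_symm x (b i)]
    rw [show ∀ z : ℂ, conj z * ((e i : ℂ) * z) = (e i : ℂ) * (z * conj z) by intro z; ring,
      Complex.mul_conj, ← Complex.ofReal_mul, Complex.ofReal_re, Complex.normSq_eq_norm_sq]
  have hext : ∀ v : U, (∀ i, inner ℂ (b i) v = 0) → v = 0 := by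
    intro v hv
    refine (map_eq_zero_iff b.repr b.repr.injective).1 ?_
    ext i
    simp [b.repr_apply_apply, hv i]
  have hzero : ∀ (p : Fin (finrank ℂ U) → Prop) (x : U),
      x ∈ Submodule.span ℂ (Set.range fun i : {i // p i} => b i) → ∀ j, ¬ p j →
        inner ℂ (b j) x = 0 := by
    intro p x hx j hj
    have : Submodule.span ℂ (Set.range fun i : {i // p i} => b i) ≤
        LinearMap.ker (innerₛₗ ℂ (b j)) := by
      rw [Submodule.span_le]
      rintro _ ⟨i, rfl⟩
      simp only [SetLike.mem_coe, LinearMap.mem_ker, innerₛₗ_apply_apply]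
      exact b.orthonormal.2 (by rintro rfl; exact hj i.2)
    simpa using this hx
  have hcard : ∀ (p : Fin (finrank ℂ U) → Prop) [DecidablePred p],
      finrank ℂ ((Submodule.span ℂ (Set.range fun i : {i // p i} => b i)).map U.subtype) =
        Fintype.card {i // p i} := by
    intro p _
    rw [Submodule.finrank_map_subtype_eq]
    exact b.finrank_span_subtype p
  classical
  refine ⟨_,
    Submodule.map_subtype_le U (Submodule.span ℂ (Set.range fun i : {i // 0 < e i} => b i)),
    _, Submodule.map_subtype_le U (Submodule.span ℂ (Set.range fun i : {i // ¬ 0 < e i} => b i)),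
    ?_, ?_, ?_, ?_⟩
  · rw [hcard, hcard, Fintype.card_subtype_compl]
    have := Fintype.card_subtype_le (fun i => 0 < e i)
    simp only [Fintype.card_fin] at *
    omega
  · rintro _ ⟨x, hx, rfl⟩ hx0
    have hx0 : x ≠ 0 := by rintro rfl; simp at hx0
    have h1 := hHx x
    rw [hexp] at h1
    have h2 : ∀ i, 0 ≤ e i * ‖inner ℂ (b i) x‖ ^ 2 := by
      intro i
      by_cases hi : 0 < e i
      · positivity
      · simp [hzero _ x hx i hi]
    have h3 : 0 < ∑ i, e i * ‖inner ℂ (b i) x‖ ^ 2 := by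
      refine lt_of_le_of_ne (Finset.sum_nonneg fun i _ => h2 i) fun h => hx0 ?_
      rw [eq_comm, Finset.sum_eq_zero_iff_of_nonneg fun i _ => h2 i] at h
      refine hext _ fun i => ?_
      by_cases hi : 0 < e i
      · simpa [hi.ne'] using h i (Finset.mem_univ i)
      · exact hzero _ x hx i hi
    simp only [Submodule.coe_subtype]
    linarith
  · rintro _ ⟨x, hx, rfl⟩
    have h1 := hHx x
    rw [hexp] at h1
    have h2 : ∑ i, e i * ‖inner ℂ (b i) x‖ ^ 2 ≤ 0 := by
      refine Finset.sum_nonpos fun i _ => ?_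
      by_cases hi : 0 < e i
      · simp [hzero _ x hx i (not_not.2 hi)]
      · exact mul_nonpos_of_nonpos_of_nonneg (not_lt.1 hi) (by positivity)
    simp only [Submodule.coe_subtype]
    linarith
  · rintro _ ⟨x, hx, rfl⟩ h0 y hy
    have h1 := hHx x
    simp only [Submodule.coe_subtype] at h0
    rw [hexp, h0, mul_zero] at h1
    have h2 : ∀ i, e i * ‖inner ℂ (b i) x‖ ^ 2 ≤ 0 := by
      intro i
      by_cases hi : 0 < e i
      · simp [hzero _ x hx i (not_not.2 hi)]
      · exact mul_nonpos_of_nonpos_of_nonneg (not_lt.1 hi) (by positivity)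
    rw [Finset.sum_eq_zero_iff_of_nonpos fun i _ => h2 i] at h1
    have h3 : H x = 0 := by
      refine hext _ fun i => ?_
      rw [← hs (b i) x, hbe, inner_smul_left]
      simpa using h1 i (Finset.mem_univ i)
    have h4 : inner ℂ (H x) (⟨y, hy⟩ : U) = 0 := by rw [h3, inner_zero_left]
    rw [hH, LinearMap.add_apply, inner_add_left, LinearMap.adjoint_inner_left,
      inner_compression_right, inner_compression_left] at h4
    simpa [add_comm] using h4

theorem exists_pos_mul_norm_sq_le (W : Submodule ℂ V) (T : V →L[ℂ] V)
    (h : ∀ x ∈ W, x ≠ 0 → 0 < (inner ℂ x (T x)).re) :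
    ∃ c > 0, ∀ x ∈ W, c * ‖x‖ ^ 2 ≤ (inner ℂ x (T x)).re := by
  have hcomp : IsCompact (Metric.sphere (0 : W) 1) := isCompact_sphere 0 1
  have hcont : Continuous fun x : W => (inner ℂ (x : V) (T x)).re := by fun_prop
  rcases (Metric.sphere (0 : W) 1).eq_empty_or_nonempty with h0 | h0
  · refine ⟨1, one_pos, fun x hx => ?_⟩
    rcases eq_or_ne x 0 with rfl | hx0
    · simp
    · exfalso
      have : (⟨((‖x‖ : ℂ)⁻¹) • x, W.smul_mem _ hx⟩ : W) ∈ Metric.sphere (0 : W) 1 := by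
        simp [norm_smul, norm_ne_zero_iff.2 hx0]
      simp [h0] at this
  · obtain ⟨u, hu, hmin⟩ := hcomp.exists_isMinOn h0 hcont.continuousOn
    have hu1 : ‖(u : V)‖ = 1 := by simpa using hu
    refine ⟨_, h u u.2 (norm_ne_zero_iff.1 (by rw [hu1]; exact one_ne_zero)), fun x hx => ?_⟩
    rcases eq_or_ne x 0 with rfl | hx0
    · simp
    · have hn : ‖x‖ ≠ 0 := norm_ne_zero_iff.2 hx0
      have hmem : (⟨((‖x‖ : ℂ)⁻¹) • x, W.smul_mem _ hx⟩ : W) ∈ Metric.sphere (0 : W) 1 := by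
        simp [norm_smul, hn]
      have h1 := hmin hmem
      simp only [Set.mem_ofPred_eq] at h1
      have h2 : (inner ℂ (((‖x‖ : ℂ)⁻¹) • x) (T (((‖x‖ : ℂ)⁻¹) • x))).re =
          (inner ℂ x (T x)).re / ‖x‖ ^ 2 := by
        rw [map_smul, inner_smul_left, inner_smul_right, ← mul_assoc,
          show conj ((‖x‖ : ℂ)⁻¹) * (‖x‖ : ℂ)⁻¹ = ((‖x‖ ^ 2)⁻¹ : ℝ) by
            simp [sq], Complex.re_ofReal_mul]
        ring
      rw [h2, le_div_iff₀ (by positivity)] at h1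
      exact h1

theorem exists_ball_pos (W : Submodule ℂ V) (T : V →L[ℂ] V)
    (h : ∀ x ∈ W, x ≠ 0 → 0 < (inner ℂ x (T x)).re) :
    ∃ c > 0, ∀ S ∈ Metric.ball T c, ∀ x ∈ W, x ≠ 0 → 0 < (inner ℂ x (S x)).re := by
  obtain ⟨c, hc, h⟩ := exists_pos_mul_norm_sq_le W T h
  refine ⟨c, hc, fun S hS x hx hx0 => ?_⟩
  have h1 := abs_le.1 (abs_re_inner_sub_le S T x)
  have h2 := h x hx
  have h3 : dist S T * ‖x‖ ^ 2 < c * ‖x‖ ^ 2 := by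
    have : 0 < ‖x‖ := norm_pos_iff.2 hx0
    gcongr
    exact hS
  linarith

theorem isOpen_posDim (U : Submodule ℂ V) (k : ℕ) : IsOpen {T : V →L[ℂ] V | PosDim U k T} := by
  rw [Metric.isOpen_iff]
  rintro T ⟨W, hWU, hW, h⟩
  obtain ⟨c, hc, h⟩ := exists_ball_pos W T h
  exact ⟨c, hc, fun S hS => ⟨W, hWU, hW, h S hS⟩⟩

/-- If the condition fails for `T`, then `-T` is positive definite on a subspace of codimension less
than `k` in `U`. That survives small perturbations, and such a subspace meets every `k`-dimensional
subspace of `U`. -/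
theorem isClosed_nonnegDim (U : Submodule ℂ V) (k : ℕ) :
    IsClosed {T : V →L[ℂ] V | NonnegDim U k T} := by
  rw [← isOpen_compl_iff, Metric.isOpen_iff]
  intro T hT
  obtain ⟨W, hWU, F, hFU, hdim, hW, hF, -⟩ := exists_pos_nonpos_split U (-T)
  have hFk : finrank ℂ F < k := by
    by_contra hk
    refine hT ⟨F, hFU, not_lt.1 hk, fun x hx => ?_⟩
    have := hF x hx
    simpa using this
  obtain ⟨c, hc, h⟩ := exists_ball_pos W (-T) hW
  refine ⟨c, hc, ?_⟩
  rintro S hS ⟨W', hW'U, hW', h'⟩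
  obtain ⟨x, hx, hx', hx0⟩ := Submodule.exists_mem_inf_ne_zero hWU hW'U (by omega)
  have h1 := h (-S) (by simpa [dist_neg_neg] using hS) x hx hx0
  have h2 := h' x hx'
  simp at h1
  linarith

end NumericalRange

/-! ### Weak and strict dimension conditions, and degenerate vectors. -/

section NumericalRange

open Module Filter Topology ComplexConjugate

variable {V : Type*} [NormedAddCommGroup V] [InnerProductSpace ℂ V]

/-- `NonnegDim` for all nonzero scalar multiples of `T`. -/
def WeakDim (U : Submodule ℂ V) (k : ℕ) (T : V →L[ℂ] V) : Prop :=
  ∀ z : ℂ, z ≠ 0 → NonnegDim U k (z • T)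

/-- `PosDim` for all nonzero scalar multiples of `T`. -/
def StrictDim (U : Submodule ℂ V) (k : ℕ) (T : V →L[ℂ] V) : Prop :=
  ∀ z : ℂ, z ≠ 0 → PosDim U k (z • T)

theorem StrictDim.weakDim {U : Submodule ℂ V} {k : ℕ} {T : V →L[ℂ] V} (h : StrictDim U k T) :
    WeakDim U k T := fun z hz => (h z hz).nonnegDim

theorem WeakDim.smul {U : Submodule ℂ V} {k : ℕ} {T : V →L[ℂ] V} (h : WeakDim U k T) {c : ℂ}
    (hc : c ≠ 0) : WeakDim U k (c • T) := fun z hz => by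
  rw [smul_smul]
  exact h _ (mul_ne_zero hz hc)

theorem inner_add_smul_map (T : V →L[ℂ] V) (x y : V) (c : ℂ) :
    inner ℂ (y + c • x) (T (y + c • x)) = inner ℂ y (T y) + c * inner ℂ y (T x) +
      conj c * inner ℂ x (T y) + conj c * c * inner ℂ x (T x) := by
  simp only [map_add, map_smul, inner_add_left, inner_add_right, inner_smul_left, inner_smul_right]
  ring

theorem Submodule.exists_add_smul_of_mem_sup_span {E : Submodule ℂ V} {x y : V}
    (h : y ∈ E ⊔ ℂ ∙ x) : ∃ w ∈ E, ∃ c : ℂ, y = w + c • x := by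
  obtain ⟨w, hw, v, hv, rfl⟩ := Submodule.mem_sup.1 h
  obtain ⟨c, rfl⟩ := Submodule.mem_span_singleton.1 hv
  exact ⟨w, hw, c, rfl⟩

variable [FiniteDimensional ℂ V]

section Reduction

variable {U : Submodule ℂ V} {T : V →L[ℂ] V} {x : V} {l : V →ₗ[ℂ] ℂ} {a b : ℂ} {k : ℕ}

/-- Cut a nonnegative `W` by `ker l`, then project it off `x`; on `ker l` the values do not change.
Only one dimension is lost: if `x ∉ W` the projection is injective on the cut, and if `x ∈ W` then
`W` already lies in `ker l`. -/
theorem nonnegDim_inf_of_nondegenerate (hxU : x ∈ U) (hx0 : x ≠ 0) (hq : inner ℂ x (T x) = 0)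
    (hl : l x = 0) (ha : ∀ y ∈ U, inner ℂ (T x) y = a * l y)
    (hb : ∀ y ∈ U, inner ℂ x (T y) = b * l y) {z : ℂ} (hz : z * conj a + conj (z * b) ≠ 0)
    (h : NonnegDim U (k + 1) (z • T)) :
    NonnegDim (U ⊓ LinearMap.ker l ⊓ (ℂ ∙ x)ᗮ) k (z • T) := by
  obtain ⟨W, hWU, hW, h⟩ := h
  have ha' : ∀ y ∈ U, inner ℂ y (T x) = conj (a * l y) := fun y hy => by
    rw [← ha y hy, inner_conj_symm]
  have hxx : inner ℂ x x ≠ 0 := inner_self_ne_zero.2 hx0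
  set π : V →ₗ[ℂ] V := LinearMap.id - ((inner ℂ x x)⁻¹ • (innerₛₗ ℂ x)).smulRight x with hπ
  have hπa : ∀ y, π y = y + (-((inner ℂ x x)⁻¹ * inner ℂ x y)) • x := by
    intro y
    simp [hπ, sub_eq_add_neg]
  set W₁ := W ⊓ LinearMap.ker l with hW₁
  have hle : W₁.map π ≤ U ⊓ LinearMap.ker l ⊓ (ℂ ∙ x)ᗮ := by
    rintro _ ⟨y, hy, rfl⟩
    have hyl : l y = 0 := hy.2
    refine ⟨⟨?_, ?_⟩, ?_⟩
    · rw [hπa]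
      exact U.add_mem (hWU hy.1) (U.smul_mem _ hxU)
    · rw [hπa]
      simp [hyl, hl]
    · rw [SetLike.mem_coe, Submodule.mem_orthogonal_singleton_iff_inner_right, hπa,
        inner_add_right, inner_smul_right]
      field_simp
      ring
  have hker : ∀ y, π y = 0 → y ∈ ℂ ∙ x := by
    intro y hy
    rw [hπa, neg_smul, add_neg_eq_zero] at hy
    exact Submodule.mem_span_singleton.2 ⟨_, hy.symm⟩
  have hrank : finrank ℂ (W₁.map π) + finrank ℂ (W₁ ⊓ ℂ ∙ x : Submodule ℂ V) ≥ finrank ℂ W₁ := by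
    have h1 := LinearMap.finrank_range_add_finrank_ker (π.domRestrict W₁)
    rw [LinearMap.range_domRestrict] at h1
    have h2 : finrank ℂ (LinearMap.ker (π.domRestrict W₁)) ≤
        finrank ℂ (W₁ ⊓ ℂ ∙ x : Submodule ℂ V) := by
      rw [← Submodule.finrank_map_subtype_eq]
      refine Submodule.finrank_mono ?_
      rintro _ ⟨y, hy, rfl⟩
      exact ⟨y.2, hker _ hy⟩
    omega
  refine ⟨_, hle, ?_, ?_⟩
  · by_cases hxW : x ∈ W
    · have hWl : W ≤ LinearMap.ker l := by
        intro w hw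
        by_contra hlw
        rw [LinearMap.mem_ker] at hlw
        -- Up to the choice of multiplier, `g` is the cross term of `w` and the isotropic `x`.
        -- Moving `w` by `-R * conj g` times `x` lowers the real part by `R * ‖g‖ ^ 2`, without
        -- bound.
        set g : ℂ := conj (l w) * (z * conj a + conj (z * b)) with hg
        have hg0 : g ≠ 0 := mul_ne_zero (by simpa using hlw) hz
        have key : ∀ R : ℝ, 0 ≤ (z * inner ℂ w (T w)).re - R * ‖g‖ ^ 2 := by
          intro R
          have h1 := h (w + (-(R : ℂ) * conj g) • x) (W.add_mem hw (W.smul_mem _ hxW))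
          rw [_root_.smul_apply, inner_smul_right, inner_add_smul_map, hq,
            ha' w (hWU hw), hb w (hWU hw)] at h1
          have h2 : (z * (conj (-(R : ℂ) * conj g) * (b * l w))).re =
              ((-(R : ℂ) * conj g) * conj (z * (b * l w))).re := by
            rw [← Complex.conj_re]
            congr 1
            simp only [map_mul, Complex.conj_conj]
            ring
          have h3 : (-(R : ℂ) * conj g) * g = ((-R * ‖g‖ ^ 2 : ℝ) : ℂ) := by
            rw [mul_assoc, mul_comm (conj g), Complex.mul_conj, Complex.normSq_eq_norm_sq]
            push_cast
            ring
          have h4 := congrArg Complex.re h3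
          rw [Complex.ofReal_re] at h4
          rw [mul_zero, add_zero, mul_add, mul_add, Complex.add_re, Complex.add_re, h2,
            add_assoc, ← Complex.add_re] at h1
          have h5 : z * (-(R : ℂ) * conj g * conj (a * l w)) +
              -(R : ℂ) * conj g * conj (z * (b * l w)) = (-(R : ℂ) * conj g) * g := by
            rw [hg]
            simp only [map_mul]
            ring
          rw [h5, h4] at h1
          linarith
        have hgp : 0 < ‖g‖ ^ 2 := by positivity
        have h6 := key (((z * inner ℂ w (T w)).re + 1) / ‖g‖ ^ 2)
        rw [div_mul_cancel₀ _ hgp.ne'] at h6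
        linarith
      have h7 : W₁ = W := inf_eq_left.2 hWl
      have h8 : finrank ℂ (W₁ ⊓ ℂ ∙ x : Submodule ℂ V) ≤ 1 :=
        (Submodule.finrank_mono inf_le_right).trans (finrank_span_singleton hx0).le
      have h9 : finrank ℂ W₁ = finrank ℂ W := by rw [h7]
      omega
    · have h7 : W₁ ⊓ ℂ ∙ x = ⊥ := by
        rw [eq_bot_iff]
        rintro y ⟨hy, hyx⟩
        obtain ⟨c, rfl⟩ := Submodule.mem_span_singleton.1 hyx
        rcases eq_or_ne c 0 with rfl | hc
        · simp
        · exact absurd ((W.smul_mem_iff hc).1 hy.1) hxW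
      have h8 := W.finrank_le_finrank_inf_ker_add_one l
      rw [← hW₁] at h8
      rw [h7, finrank_bot] at hrank
      omega
  · rintro _ ⟨y, hy, rfl⟩
    have hyl : l y = 0 := hy.2
    have h1 := h y hy.1
    rw [hπa, _root_.smul_apply, inner_smul_right, inner_add_smul_map, hq,
      ha' y (hWU hy.1), hb y (hWU hy.1), hyl]
    rw [_root_.smul_apply, inner_smul_right] at h1
    simpa using h1

theorem WeakDim.inf (hxU : x ∈ U) (hx0 : x ≠ 0) (hq : inner ℂ x (T x) = 0)
    (hl : l x = 0) (ha : ∀ y ∈ U, inner ℂ (T x) y = a * l y)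
    (hb : ∀ y ∈ U, inner ℂ x (T y) = b * l y) (hab : a ≠ 0 ∨ b ≠ 0)
    (h : WeakDim U (k + 1) T) : WeakDim (U ⊓ LinearMap.ker l ⊓ (ℂ ∙ x)ᗮ) k T := by
  intro z hz
  by_cases hd : z * conj a + conj (z * b) = 0
  swap
  · exact nonnegDim_inf_of_nondegenerate hxU hx0 hq hl ha hb hd (h z hz)
  have ha0 : a ≠ 0 := by
    rintro rfl
    simp [hz] at hd
    simp [hd] at hab
  -- Since `a ≠ 0`, rotating the exceptional `z` slightly makes the cross coefficient nonzero;
  -- closedness of `NonnegDim` then returns to `z`.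
  have hne : ∀ n : ℕ, (1 + ((1 / ((n : ℝ) + 1) : ℝ) : ℂ) * Complex.I) ≠ 0 := by
    intro n hn
    have := congrArg Complex.re hn
    simp at this
  have hlim : Tendsto (fun n : ℕ => (z * (1 + ((1 / ((n : ℝ) + 1) : ℝ) : ℂ) * Complex.I)) • T)
      atTop (𝓝 (z • T)) := by
    have h1 : Tendsto (fun n : ℕ => ((1 / ((n : ℝ) + 1) : ℝ) : ℂ)) atTop (𝓝 ((0 : ℝ) : ℂ)) :=
      (Complex.continuous_ofReal.tendsto 0).comp tendsto_one_div_add_atTop_nhds_zero_nat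
    have h2 := ((((h1.mul_const Complex.I).const_add 1).const_mul z).smul_const T)
    simpa using h2
  refine (isClosed_nonnegDim _ k).mem_of_tendsto hlim (Eventually.of_forall fun n => ?_)
  refine nonnegDim_inf_of_nondegenerate hxU hx0 hq hl ha hb ?_ (h _ (mul_ne_zero hz (hne n)))
  have hr : (1 / ((n : ℝ) + 1)) ≠ 0 := by positivity
  set r : ℝ := 1 / ((n : ℝ) + 1)
  have h3 : z * (1 + (r : ℂ) * Complex.I) * conj a + conj (z * (1 + (r : ℂ) * Complex.I) * b) =
      (z * conj a + conj (z * b)) * (1 - r * Complex.I) + 2 * r * Complex.I * (z * conj a) := by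
    simp only [map_mul, map_add, map_one, Complex.conj_ofReal, Complex.conj_I]
    ring
  rw [h3, hd, zero_mul, zero_add]
  simp [hr, hz, ha0]

end Reduction

/-- An isotropic vector of `T` on `U` at which the forms of `T` and its adjoint are linearly
dependent. -/
def HasDegenerateVector (U : Submodule ℂ V) (T : V →L[ℂ] V) : Prop :=
  ∃ x ∈ U, x ≠ 0 ∧ inner ℂ x (T x) = 0 ∧ ∃ (l : V →ₗ[ℂ] ℂ) (a b : ℂ), l x = 0 ∧
    (∀ y ∈ U, inner ℂ (T x) y = a * l y) ∧ (∀ y ∈ U, inner ℂ x (T y) = b * l y) ∧ (a ≠ 0 ∨ b ≠ 0)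

/-- For small `ε > 0`, `F` meets a nonnegative subspace of `(1 + iεs) T`. A common unit vector with
value `q` satisfies `εs * q.im ≤ q.re ≤ 0`; a limit point as `ε → 0` is the required vector. -/
theorem exists_unit_re_eq_zero {U F : Submodule ℂ V} {k : ℕ} {T : V →L[ℂ] V} (h : WeakDim U k T)
    (hFU : F ≤ U) (hFk : finrank ℂ U < finrank ℂ F + k) (hF : ∀ x ∈ F, (inner ℂ x (T x)).re ≤ 0)
    (s : ℝ) : ∃ x ∈ F, x ≠ 0 ∧ (inner ℂ x (T x)).re = 0 ∧ s * (inner ℂ x (T x)).im ≤ 0 := by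
  have hne : ∀ n : ℕ, (1 + ((s * (1 / ((n : ℝ) + 1)) : ℝ) : ℂ) * Complex.I) ≠ 0 := by
    intro n hn
    have := congrArg Complex.re hn
    simp at this
  have hstep : ∀ n : ℕ, ∃ x : F, x ∈ Metric.sphere (0 : F) 1 ∧
      s * (1 / ((n : ℝ) + 1)) * (inner ℂ (x : V) (T x)).im ≤ (inner ℂ (x : V) (T x)).re := by
    intro n
    obtain ⟨W, hWU, hW, hpos⟩ := h _ (hne n)
    obtain ⟨x, hxF, hxW, hx0⟩ := Submodule.exists_mem_inf_ne_zero hFU hWU (by omega)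
    have hn : ‖x‖ ≠ 0 := norm_ne_zero_iff.2 hx0
    refine ⟨⟨((‖x‖ : ℂ)⁻¹) • x, F.smul_mem _ hxF⟩, by simp [norm_smul, hn], ?_⟩
    have h1 := hpos _ (W.smul_mem ((‖x‖ : ℂ)⁻¹) hxW)
    rw [_root_.smul_apply, inner_smul_right] at h1
    generalize inner ℂ (((‖x‖ : ℂ)⁻¹) • x) (T (((‖x‖ : ℂ)⁻¹) • x)) = w at h1 ⊢
    simp only [Complex.mul_re, Complex.add_re, Complex.add_im, Complex.one_re, Complex.one_im,
      Complex.mul_im, Complex.ofReal_re, Complex.ofReal_im, Complex.I_re, Complex.I_im] at h1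
    linarith
  choose u hu hu' using hstep
  obtain ⟨x, hx, φ, hφ, hlim⟩ := (isCompact_sphere (0 : F) 1).tendsto_subseq hu
  have hx1 : ‖(x : V)‖ = 1 := by simpa using hx
  have hre : Continuous fun x : F => (inner ℂ (x : V) (T x)).re := by fun_prop
  have him : Continuous fun x : F => (inner ℂ (x : V) (T x)).im := by fun_prop
  have h1 := (hre.tendsto x).comp hlim
  have h2 := (him.tendsto x).comp hlim
  have h3 : Tendsto (fun n => s * (1 / ((φ n : ℝ) + 1))) atTop (𝓝 (s * 0)) :=
    (tendsto_one_div_add_atTop_nhds_zero_nat.comp hφ.tendsto_atTop).const_mul s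
  have h4 := le_of_tendsto_of_tendsto' (h3.mul h2) h1 fun n => hu' (φ n)
  refine ⟨x, x.2, norm_ne_zero_iff.1 (by rw [hx1]; exact one_ne_zero),
    le_antisymm (hF x x.2) (by simpa using h4), ?_⟩
  refine le_of_tendsto' (h2.const_mul s) fun n => ?_
  have h5 := (hu' (φ n)).trans (hF _ (u (φ n)).2)
  have h6 : (0 : ℝ) < 1 / ((φ n : ℝ) + 1) := by positivity
  by_contra h7
  have := mul_pos h6 (not_le.1 h7)
  simp only [Function.comp_apply] at this
  linarith

/-- At a `z` where strictness fails, there are radical vectors of the real part of `z • T` with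
imaginary values of both signs. The radical is linear, so the intermediate value theorem on a
segment gives an isotropic one, and being radical makes the two forms proportional. -/
theorem WeakDim.hasDegenerateVector_of_not_strictDim {U : Submodule ℂ V} {k : ℕ} {T : V →L[ℂ] V}
    (h : WeakDim U k T) (hs : ¬ StrictDim U k T) : HasDegenerateVector U T := by
  simp only [StrictDim, not_forall] at hs
  obtain ⟨z, hz, hs⟩ := hs
  have h0 := h.smul hz
  obtain ⟨W, hWU, F, hFU, hdim, hW, hF, hrad⟩ := exists_pos_nonpos_split U (z • T)
  have hWk : finrank ℂ W < k := by
    by_contra hk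
    exact hs ⟨W, hWU, not_lt.1 hk, hW⟩
  obtain ⟨x₁, hx₁, hx₁0, hx₁r, hx₁i⟩ := exists_unit_re_eq_zero h0 hFU (by omega) hF 1
  obtain ⟨x₂, hx₂, hx₂0, hx₂r, hx₂i⟩ := exists_unit_re_eq_zero h0 hFU (by omega) hF (-1)
  suffices hx : ∃ x ∈ U, x ≠ 0 ∧ inner ℂ x ((z • T) x) = 0 ∧
      ∀ y ∈ U, inner ℂ x ((z • T) y) + inner ℂ ((z • T) x) y = 0 by
    obtain ⟨x, hxU, hx0, hq, hx⟩ := hx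
    simp only [_root_.smul_apply, inner_smul_right, inner_smul_left] at hq hx
    have hq' : inner ℂ x (T x) = 0 := by simpa [hz] using hq
    refine ⟨x, hxU, hx0, hq', innerₛₗ ℂ (T x), 1, -(conj z) / z, ?_, ?_, ?_, Or.inl one_ne_zero⟩
    · rw [innerₛₗ_apply_apply, ← inner_conj_symm, hq', map_zero]
    · simp
    · intro y hy
      rw [innerₛₗ_apply_apply]
      field_simp
      linear_combination hx y hy
  have e₁ := hrad x₁ hx₁ hx₁r
  have e₂ := hrad x₂ hx₂ hx₂r
  generalize z • T = S at *
  have hcont : ContinuousOn (fun t : ℝ => (inner ℂ (((1 - t : ℝ) : ℂ) • x₁ + (t : ℂ) • x₂)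
      (S (((1 - t : ℝ) : ℂ) • x₁ + (t : ℂ) • x₂))).im) (Set.Icc 0 1) :=
    Continuous.continuousOn (by fun_prop)
  have hivt := intermediate_value_Icc zero_le_one hcont
  have hmem : (0 : ℝ) ∈ Set.Icc
      ((inner ℂ (((1 - (0 : ℝ) : ℝ) : ℂ) • x₁ + ((0 : ℝ) : ℂ) • x₂)
      (S (((1 - (0 : ℝ) : ℝ) : ℂ) • x₁ + ((0 : ℝ) : ℂ) • x₂))).im)
      ((inner ℂ (((1 - (1 : ℝ) : ℝ) : ℂ) • x₁ + ((1 : ℝ) : ℂ) • x₂)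
      (S (((1 - (1 : ℝ) : ℝ) : ℂ) • x₁ + ((1 : ℝ) : ℂ) • x₂))).im) := by
    constructor
    · simpa using hx₁i
    · simpa using hx₂i
  obtain ⟨t, ht, ht0⟩ := hivt hmem
  simp only at ht0
  set x := ((1 - t : ℝ) : ℂ) • x₁ + (t : ℂ) • x₂ with hx
  have hrx : ∀ y ∈ U, inner ℂ x (S y) + inner ℂ (S x) y = 0 := by
    intro y hy
    simp only [hx, map_add, map_smul, inner_add_left, inner_smul_left]
    linear_combination conj ((1 - t : ℝ) : ℂ) * e₁ y hy + conj (t : ℂ) * e₂ y hy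
  have hxF : x ∈ F := F.add_mem (F.smul_mem _ hx₁) (F.smul_mem _ hx₂)
  by_cases hx0 : x = 0
  -- If the segment passes through zero, `x₁` is a real multiple of `x₂`; its imaginary value then
  -- has both signs and vanishes.
  · refine ⟨x₁, hFU hx₁, hx₁0, Complex.ext hx₁r (le_antisymm (by simpa using hx₁i) ?_), e₁⟩
    have ht1 : (1 - t : ℝ) ≠ 0 := by
      intro h1
      have : t = 1 := by linarith
      rw [hx, this] at hx0
      simp [hx₂0] at hx0
    have h2 : x₁ = ((-(t / (1 - t)) : ℝ) : ℂ) • x₂ := by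
      have h3 : ((1 - t : ℝ) : ℂ) ≠ 0 := by exact_mod_cast ht1
      rw [← smul_right_inj h3, smul_smul, ← Complex.ofReal_mul,
        show (1 - t) * -(t / (1 - t)) = -t by field_simp, Complex.ofReal_neg, neg_smul]
      exact eq_neg_of_add_eq_zero_left hx0
    rw [h2, map_smul, inner_smul_left, inner_smul_right, Complex.conj_ofReal, ← mul_assoc,
      ← Complex.ofReal_mul, Complex.im_ofReal_mul]
    exact mul_nonneg (mul_self_nonneg _) (by simpa using hx₂i)
  · refine ⟨x, hFU hxF, hx0, Complex.ext ?_ ht0, hrx⟩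
    have h1 := congrArg Complex.re (hrx x (hFU hxF))
    rw [← inner_conj_symm (S x) x, Complex.add_re, Complex.conj_re] at h1
    simp only [Complex.zero_re] at h1 ⊢
    linarith

/-- With `finrank ℂ U ≤ 2 * k`, positive and negative subspaces span `U`, so no rotation of `T` has
a real part with a radical. Take an eigenvector `S x = c S* x` of the pencil of the compression `S`:
`‖c‖ = 1` would give a radical vector, and `‖c‖ ≠ 1` forces `x` to be isotropic. If `S*` is
singular, a kernel vector serves. -/
theorem StrictDim.hasDegenerateVector {U : Submodule ℂ V} {k : ℕ} {T : V →L[ℂ] V}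
    (h : StrictDim U k T) (hU : finrank ℂ U ≤ 2 * k) (hU0 : 0 < finrank ℂ U) :
    HasDegenerateVector U T := by
  have hnd : ∀ z : ℂ, z ≠ 0 → ∀ x ∈ U,
      (∀ y ∈ U, inner ℂ x ((z • T) y) + inner ℂ ((z • T) x) y = 0) → x = 0 := by
    intro z hz x hx hrad
    obtain ⟨W, hWU, hW, hWp⟩ := h z hz
    obtain ⟨F, hFU, hF, hFp⟩ := h (-z) (neg_ne_zero.2 hz)
    rw [neg_smul] at hFp
    generalize z • T = S at *
    have hdisj : W ⊓ F = ⊥ := by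
      rw [eq_bot_iff]
      rintro y ⟨hy1, hy2⟩
      by_contra hy0
      have h1 := hWp y hy1 hy0
      have h2 := hFp y hy2 hy0
      simp at h2
      linarith
    have hsup : W ⊔ F = U := by
      refine Submodule.eq_of_le_of_finrank_le (sup_le hWU hFU) ?_
      have := Submodule.finrank_sup_add_finrank_inf_eq W F
      rw [hdisj, finrank_bot] at this
      omega
    rw [← hsup] at hx
    obtain ⟨w, hw, f, hf, rfl⟩ := Submodule.mem_sup.1 hx
    have h1 := congrArg Complex.re (hrad w (hWU hw))
    have h2 := congrArg Complex.re (hrad f (hFU hf))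
    simp only [map_add, inner_add_left, Complex.add_re, Complex.zero_re] at h1 h2
    have c : ∀ p q : V, (inner ℂ (S p) q).re = (inner ℂ q (S p)).re := fun p q => by
      rw [← inner_conj_symm, Complex.conj_re]
    rw [c, c] at h1 h2
    have hw' : w = 0 := by
      by_contra hw0
      have h3 := hWp w hw hw0
      have h4 : 0 ≤ (inner ℂ f ((-S) f)).re := by
        rcases eq_or_ne f 0 with rfl | hf0
        · simp
        · exact (hFp f hf hf0).le
      simp at h4
      linarith
    have hf' : f = 0 := by
      by_contra hf0
      have h3 := hFp f hf hf0
      simp [hw'] at h2 h3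
      linarith
    rw [hw', hf', add_zero]
  set S := compression U T with hS
  have hadj : ∀ x y : U, inner ℂ (LinearMap.adjoint S x) y = inner ℂ (x : V) (T y) := fun x y => by
    rw [LinearMap.adjoint_inner_left, inner_compression_right]
  by_cases hinj : Function.Injective (LinearMap.adjoint S)
  · have : Nontrivial U := finrank_pos_iff.1 hU0
    set A := LinearEquiv.ofInjectiveEndo _ hinj with hA
    obtain ⟨c, hc⟩ := Module.End.exists_eigenvalue ((A.symm : U →ₗ[ℂ] U) ∘ₗ S)
    obtain ⟨x, hx⟩ := hc.exists_hasEigenvector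
    have hx0 : x ≠ 0 := hx.2
    have hSx : S x = c • LinearMap.adjoint S x := by
      have h1 := hx.apply_eq_smul
      simp only [LinearMap.comp_apply, LinearEquiv.coe_coe] at h1
      rw [LinearEquiv.symm_apply_eq, map_smul] at h1
      exact h1
    have hdep : ∀ y ∈ U, inner ℂ (T x) y = conj c * inner ℂ (x : V) (T y) := by
      intro y hy
      rw [← hadj x ⟨y, hy⟩, ← inner_smul_left, ← hSx, inner_compression_left]
    have hc1 : ‖c‖ ≠ 1 := by
      intro hc1
      have hcc : c * conj c = 1 := by
        rw [Complex.mul_conj, Complex.normSq_eq_norm_sq, hc1]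
        simp
      -- For this `z`, the Hermitian part of `z • S` kills `x`. The witness `1 - conj c` works on
      -- the unit circle except at `c = 1`, where it vanishes.
      obtain ⟨z, hz, hzc⟩ : ∃ z : ℂ, z ≠ 0 ∧ z + conj (z * c) = 0 := by
        by_cases h1 : c = 1
        · exact ⟨Complex.I, Complex.I_ne_zero, by simp [h1]⟩
        · refine ⟨1 - conj c, ?_, ?_⟩
          · intro h2
            apply h1
            have := congrArg conj (sub_eq_zero.1 h2)
            simpa using this.symm
          · simp only [map_mul, map_sub, map_one, Complex.conj_conj]
            linear_combination -hcc
      refine hx0 (Subtype.ext (hnd z hz x x.2 fun y hy => ?_))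
      rw [_root_.smul_apply, _root_.smul_apply, inner_smul_left,
        inner_smul_right, hdep y hy]
      rw [map_mul] at hzc
      linear_combination inner ℂ (x : V) (T y) * hzc
    have hq : inner ℂ (x : V) (T x) = 0 := by
      have h1 := hdep x x.2
      rw [← inner_conj_symm] at h1
      have h2 := congrArg norm h1
      rw [norm_mul, RCLike.norm_conj, RCLike.norm_conj] at h2
      by_contra h3
      have h4 : ‖inner ℂ (x : V) (T x)‖ ≠ 0 := norm_ne_zero_iff.2 h3
      exact hc1 (mul_right_cancel₀ h4 (by rw [one_mul]; exact h2.symm))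
    refine ⟨x, x.2, by simpa using hx0, hq, innerₛₗ ℂ (x : V) ∘ₗ (T : V →ₗ[ℂ] V), conj c, 1,
      by simpa using hq, ?_, ?_, Or.inr one_ne_zero⟩
    · simpa using hdep
    · simp
  · rw [← LinearMap.ker_eq_bot] at hinj
    obtain ⟨x, hx, hx0⟩ := Submodule.exists_mem_ne_zero_of_ne_bot hinj
    have h0 : ∀ y ∈ U, inner ℂ (x : V) (T y) = 0 := fun y hy => by
      rw [← hadj x ⟨y, hy⟩, LinearMap.mem_ker.1 hx, inner_zero_left]
    have hq := h0 x x.2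
    refine ⟨x, x.2, by simpa using hx0, hq, innerₛₗ ℂ (T x), 1, 0, ?_, ?_, ?_, Or.inl one_ne_zero⟩
    · rw [innerₛₗ_apply_apply, ← inner_conj_symm, hq, map_zero]
    · simp
    · simpa using h0

end NumericalRange

/-! ### Isotropic subspaces, by induction on their dimension. -/

section NumericalRange

open Module Filter Topology ComplexConjugate

variable {V : Type*} [NormedAddCommGroup V] [InnerProductSpace ℂ V]

/-- Every vector of `E` is isotropic for `T`. -/
def IsotropicOn (E : Submodule ℂ V) (T : V →L[ℂ] V) : Prop :=
  ∀ x ∈ E, inner ℂ x (T x) = 0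

theorem inner_sub_smul_one (T : V →L[ℂ] V) (c : ℂ) (x : V) :
    inner ℂ x ((T - c • 1) x) = inner ℂ x (T x) - c * ‖x‖ ^ 2 := by
  rw [_root_.sub_apply, inner_sub_right, _root_.smul_apply, inner_smul_right,
    one_apply_eq_self, inner_self_eq_norm_sq_to_K]
  rfl

theorem inner_smul_sub_smul_one (T : V →L[ℂ] V) (c z : ℂ) (x : V) :
    inner ℂ x ((z • (T - c • 1)) x) = z * (inner ℂ x (T x) - c * ‖x‖ ^ 2) := by
  rw [_root_.smul_apply, inner_smul_right, inner_sub_smul_one]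

theorem isotropicOn_sub_smul_one_iff {E : Submodule ℂ V} {T : V →L[ℂ] V} {c : ℂ} :
    IsotropicOn E (T - c • 1) ↔ ∀ x ∈ E, inner ℂ x (T x) = c * ‖x‖ ^ 2 := by
  refine forall₂_congr fun x _ => ?_
  rw [inner_sub_smul_one, sub_eq_zero]

variable [FiniteDimensional ℂ V]

/-- Lying in `ker l` kills the cross terms of `E` with `x`, and orthogonality to `x` makes the sum
direct. -/
theorem HasDegenerateVector.exists_isotropicOn {U : Submodule ℂ V} {k : ℕ} {T : V →L[ℂ] V}
    (ih : ∀ (U : Submodule ℂ V) (T : V →L[ℂ] V), WeakDim U k T →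
      ∃ E ≤ U, finrank ℂ E = k ∧ IsotropicOn E T)
    (hd : HasDegenerateVector U T) (h : WeakDim U (k + 1) T) :
    ∃ E ≤ U, finrank ℂ E = k + 1 ∧ IsotropicOn E T := by
  obtain ⟨x, hxU, hx0, hq, l, a, b, hl, ha, hb, hab⟩ := hd
  obtain ⟨E, hE, hEk, hiso⟩ := ih _ _ (h.inf hxU hx0 hq hl ha hb hab)
  have hEU : E ≤ U := fun y hy => (hE hy).1.1
  have hdisj : E ⊓ ℂ ∙ x = ⊥ := by
    rw [eq_bot_iff]
    rintro y ⟨hy, hyx⟩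
    exact inner_self_eq_zero.1 (Submodule.mem_orthogonal _ _ |>.1 (hE hy).2 y hyx)
  refine ⟨E ⊔ ℂ ∙ x, sup_le hEU (by simpa using hxU), ?_, ?_⟩
  · have := Submodule.finrank_sup_add_finrank_inf_eq E (ℂ ∙ x)
    rw [hdisj, finrank_bot, finrank_span_singleton hx0] at this
    omega
  · intro y hy
    obtain ⟨w, hw, c, rfl⟩ := Submodule.exists_add_smul_of_mem_sup_span hy
    have hlw : l w = 0 := (hE hw).1.2
    have h1 : inner ℂ w (T x) = 0 := by
      rw [← inner_conj_symm, ha w (hEU hw), hlw, mul_zero, map_zero]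
    rw [inner_add_smul_map, hiso w hw, h1, hb w (hEU hw), hlw, hq]
    simp

theorem eventually_strictDim {U : Submodule ℂ V} {k : ℕ} {f : ℝ → V →L[ℂ] V} (hf : Continuous f)
    {t : ℝ} (h : StrictDim U k (f t)) : ∀ᶠ s in 𝓝 t, StrictDim U k (f s) := by
  have h1 : ∀ᶠ s in 𝓝 t, ∀ z ∈ Metric.sphere (0 : ℂ) 1, PosDim U k (z • f s) := by
    refine (isCompact_sphere (0 : ℂ) 1).eventually_forall_of_forall_eventually fun z hz => ?_
    have hc : Continuous fun p : ℝ × ℂ => p.2 • f p.1 := by fun_prop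
    refine hc.continuousAt.eventually_mem ((isOpen_posDim U k).mem_nhds ?_)
    exact h z (by rintro rfl; simp at hz)
  filter_upwards [h1] with s hs z hz
  have hn : ‖z‖ ≠ 0 := norm_ne_zero_iff.2 hz
  obtain ⟨W, hWU, hW, hp⟩ := hs ((‖z‖ : ℂ)⁻¹ * z) (by simp [hn])
  refine ⟨W, hWU, hW, fun x hx hx0 => ?_⟩
  have h2 := hp x hx hx0
  rw [mul_smul, _root_.smul_apply, inner_smul_right, ← Complex.ofReal_inv,
    Complex.re_ofReal_mul] at h2
  exact pos_of_mul_pos_right h2 (by positivity)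

/-- Take the largest `t` for which the weak condition holds. It exists by closedness and the norm
bound; strictness is open, so it fails there, and it holds at `0`, so `t > 0`. -/
theorem StrictDim.exists_pos_shift {U : Submodule ℂ V} {k : ℕ} {T : V →L[ℂ] V}
    (h : StrictDim U (k + 1) T) {s : ℝ} (hs : s ≠ 0) :
    ∃ t : ℝ, 0 < t ∧ WeakDim U (k + 1) (T - ((s * t : ℝ) : ℂ) • 1) ∧
      ¬ StrictDim U (k + 1) (T - ((s * t : ℝ) : ℂ) • 1) := by
  set f : ℝ → V →L[ℂ] V := fun t => T - ((s * t : ℝ) : ℂ) • 1 with hf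
  have hfc : Continuous f := by fun_prop
  set A : Set ℝ := {t | WeakDim U (k + 1) (f t)} with hA
  have hAc : IsClosed A := by
    have : A = ⋂ (z : ℂ) (_ : z ≠ 0), {t | NonnegDim U (k + 1) (z • f t)} := by
      ext t
      simp [hA, WeakDim]
    rw [this]
    exact isClosed_iInter fun z => isClosed_iInter fun _ =>
      (isClosed_nonnegDim U (k + 1)).preimage (hfc.const_smul z)
  have h0 : (0 : ℝ) ∈ A := by
    have : f 0 = T := by simp [hf]
    simpa [hA, this] using h.weakDim
  have hAb : BddAbove A := by
    refine ⟨‖T‖ / |s|, fun t ht => ?_⟩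
    obtain ⟨W, hWU, hW, hp⟩ := ht ((|s| / s : ℝ) : ℂ) (by
      exact_mod_cast div_ne_zero (abs_ne_zero.2 hs) hs)
    have hW0 : W ≠ ⊥ := by
      rintro rfl
      simp at hW
    obtain ⟨x, hx, hx0⟩ := Submodule.exists_mem_ne_zero_of_ne_bot hW0
    have h1 := hp x hx
    have hxp : 0 < ‖x‖ ^ 2 := by have := norm_pos_iff.2 hx0; positivity
    rw [hf, inner_smul_sub_smul_one, Complex.re_ofReal_mul, Complex.sub_re,
      ← Complex.ofReal_pow, ← Complex.ofReal_mul, Complex.ofReal_re, mul_sub,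
      show |s| / s * (s * t * ‖x‖ ^ 2) = |s| * t * ‖x‖ ^ 2 by field_simp] at h1
    have h2 : |s| / s * (inner ℂ x (T x)).re ≤ ‖T‖ * ‖x‖ ^ 2 := by
      refine (le_abs_self _).trans ?_
      rw [abs_mul, abs_div, abs_abs, div_self (abs_ne_zero.2 hs), one_mul]
      simpa using abs_re_inner_sub_le T 0 x
    rw [le_div_iff₀ (abs_pos.2 hs)]
    have h3 : |s| * t * ‖x‖ ^ 2 ≤ ‖T‖ * ‖x‖ ^ 2 := by linarith
    have := le_of_mul_le_mul_right h3 hxp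
    linarith
  have hmem : sSup A ∈ A := hAc.csSup_mem ⟨0, h0⟩ hAb
  have hns : ¬ StrictDim U (k + 1) (f (sSup A)) := by
    intro hst
    obtain ⟨ε, hε, hball⟩ := Metric.eventually_nhds_iff.1 (eventually_strictDim hfc hst)
    have h1 : sSup A + ε / 2 ∈ A :=
      (hball (y := sSup A + ε / 2) (by simp [abs_of_pos hε, hε])).weakDim
    have := le_csSup hAb h1
    linarith
  refine ⟨sSup A, lt_of_le_of_ne (le_csSup hAb h0) fun h1 => hns ?_, hmem, hns⟩
  rw [← h1]
  simpa [hf] using h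

/-- If every rotation of `T` has a `k`-dimensional subspace of `U` on which its real part is
nonnegative, then `U` contains a `k`-dimensional isotropic subspace of `T`. -/
theorem WeakDim.exists_isotropicOn (k : ℕ) : ∀ (U : Submodule ℂ V) (T : V →L[ℂ] V),
    WeakDim U k T → ∃ E ≤ U, finrank ℂ E = k ∧ IsotropicOn E T := by
  induction k with
  | zero => exact fun U T _ => ⟨⊥, bot_le, finrank_bot _ _, fun x hx => by
      rw [(Submodule.mem_bot ℂ).1 hx, inner_zero_left]⟩
  | succ k ih =>
    have ns : ∀ (U : Submodule ℂ V) (T : V →L[ℂ] V), WeakDim U (k + 1) T →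
        ¬ StrictDim U (k + 1) T → ∃ E ≤ U, finrank ℂ E = k + 1 ∧ IsotropicOn E T :=
      fun U T h hs => (h.hasDegenerateVector_of_not_strictDim hs).exists_isotropicOn ih h
    intro U T h
    by_cases hs : StrictDim U (k + 1) T
    swap
    · exact ns U T h hs
    -- Shifting both ways to the edge of strictness gives subspaces where the form is `t₁ > 0` and
    -- `-t₂ < 0` times the squared norm. One or the other serves each `z`, according to the sign of
    -- `z.re`, so the weak condition passes to `E₁ ⊔ E₂`, of dimension at most `2 * (k + 1)`.
    obtain ⟨t₁, ht₁, hw₁, hn₁⟩ := hs.exists_pos_shift one_ne_zero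
    obtain ⟨t₂, ht₂, hw₂, hn₂⟩ := hs.exists_pos_shift (s := -1) (by norm_num)
    obtain ⟨E₁, hE₁U, hE₁, hi₁⟩ := ns U _ hw₁ hn₁
    obtain ⟨E₂, hE₂U, hE₂, hi₂⟩ := ns U _ hw₂ hn₂
    rw [isotropicOn_sub_smul_one_iff] at hi₁ hi₂
    have hle : E₁ ⊔ E₂ ≤ U := sup_le hE₁U hE₂U
    have hw : WeakDim (E₁ ⊔ E₂) (k + 1) T := by
      intro z hz
      rcases le_total 0 z.re with hz | hz
      · refine ⟨E₁, le_sup_left, hE₁.ge, fun x hx => ?_⟩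
        rw [_root_.smul_apply, inner_smul_right, hi₁ x hx, ← Complex.ofReal_pow,
          ← Complex.ofReal_mul, Complex.re_mul_ofReal]
        positivity
      · refine ⟨E₂, le_sup_right, hE₂.ge, fun x hx => ?_⟩
        rw [_root_.smul_apply, inner_smul_right, hi₂ x hx, ← Complex.ofReal_pow,
          ← Complex.ofReal_mul, Complex.re_mul_ofReal]
        refine mul_nonneg_of_nonpos_of_nonpos hz ?_
        rw [neg_one_mul, neg_mul, neg_nonpos]
        positivity
    suffices h : ∃ E ≤ E₁ ⊔ E₂, finrank ℂ E = k + 1 ∧ IsotropicOn E T by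
      obtain ⟨E, hE, h⟩ := h
      exact ⟨E, hE.trans hle, h⟩
    by_cases hst : StrictDim (E₁ ⊔ E₂) (k + 1) T
    · refine (hst.hasDegenerateVector ?_ ?_).exists_isotropicOn ih hw
      · have := Submodule.finrank_add_le_finrank_add_finrank E₁ E₂
        omega
      · have := Submodule.finrank_mono (le_sup_left : E₁ ≤ E₁ ⊔ E₂)
        omega
    · exact ns _ _ hw hst

/-! ### The choice of the centre by Helly's theorem. -/

/-- The unit numerical values of `T` on `F`. -/
def numericalValues (T : V →L[ℂ] V) (F : Submodule ℂ V) : Set ℂ :=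
  (fun x => inner ℂ x (T x)) '' {x | x ∈ F ∧ ‖x‖ = 1}

theorem isCompact_closure_convexHull_numericalValues (T : V →L[ℂ] V) (F : Submodule ℂ V) :
    IsCompact (closure (convexHull ℝ (numericalValues T F))) := by
  refine Metric.isCompact_of_isClosed_isBounded isClosed_closure
    (isBounded_convexHull.2 (IsCompact.isBounded (IsCompact.image ?_ (by fun_prop)))).closure
  have : {x | x ∈ F ∧ ‖x‖ = 1} = (F : Set V) ∩ Metric.sphere 0 1 := by
    ext x
    simp
  rw [this]
  exact (isCompact_sphere (0 : V) 1).inter_left F.closed_of_finiteDimensional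

theorem Submodule.finrank_le_finrank_biInf {ι : Type*} (F : ι → Submodule ℂ V) (d : ℕ)
    (hF : ∀ i, finrank ℂ V ≤ finrank ℂ (F i) + d) (I : Finset ι) :
    finrank ℂ V ≤ finrank ℂ (⨅ i ∈ I, F i : Submodule ℂ V) + I.card * d := by
  classical
  induction I using Finset.induction_on with
  | empty =>
    rw [show (⨅ i ∈ (∅ : Finset ι), F i) = ⊤ by simp, finrank_top]
    exact Nat.le_add_right _ _
  | insert i I hi ih =>
    rw [Finset.iInf_insert, Finset.card_insert_of_notMem hi]
    have h1 := Submodule.finrank_sup_add_finrank_inf_eq (F i) (⨅ i ∈ I, F i)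
    have h2 := Submodule.finrank_le (F i ⊔ ⨅ i ∈ I, F i)
    have h3 := hF i
    rw [add_mul, one_mul]
    omega

theorem exists_weakDim_sub_smul_one (T : V →L[ℂ] V) {m : ℕ} (h : 3 * m < finrank ℂ V) :
    ∃ c : ℂ, WeakDim ⊤ (m + 1) (T - c • 1) := by
  have hH := Convex.helly_theorem_compact' (𝕜 := ℝ)
    (F := fun F : {F : Submodule ℂ V // finrank ℂ V ≤ finrank ℂ F + m} =>
      closure (convexHull ℝ (numericalValues T F)))
    (fun F => (convex_convexHull ℝ _).closure)
    (fun F => isCompact_closure_convexHull_numericalValues T F)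
    -- Helly in the real plane needs triples: three subspaces of codimension at most `m` share a
    -- unit vector because `3 * m < finrank ℂ V`, and its value lies in all three hulls.
    (fun I hI => by
      have h1 := Submodule.finrank_le_finrank_biInf
        (fun F : {F : Submodule ℂ V // finrank ℂ V ≤ finrank ℂ F + m} => (F : Submodule ℂ V)) m
        (fun F => F.2) I
      rw [Complex.finrank_real_complex] at hI
      have h2 : I.card * m ≤ 3 * m := Nat.mul_le_mul_right m hI
      have h3 : (⨅ F ∈ I, (F : Submodule ℂ V)) ≠ ⊥ := by
        intro h0
        rw [h0, finrank_bot] at h1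
        omega
      obtain ⟨x, hx, hx0⟩ := Submodule.exists_mem_ne_zero_of_ne_bot h3
      have hn : ‖x‖ ≠ 0 := norm_ne_zero_iff.2 hx0
      refine ⟨inner ℂ (((‖x‖ : ℂ)⁻¹) • x) (T (((‖x‖ : ℂ)⁻¹) • x)), Set.mem_iInter₂.2 fun F hF => ?_⟩
      refine subset_closure <| subset_convexHull ℝ _
        ⟨_, ⟨Submodule.smul_mem _ _ ?_, by simp [norm_smul, hn]⟩, rfl⟩
      rw [Submodule.mem_iInf] at hx
      have := hx F
      rw [Submodule.mem_iInf] at this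
      exact this hF)
  obtain ⟨c, hc⟩ := hH
  refine ⟨c, fun z hz => ?_⟩
  obtain ⟨W, -, F, -, hdim, hW, hF, -⟩ := exists_pos_nonpos_split ⊤ (-(z • (T - c • 1)))
  rw [finrank_top] at hdim
  refine ⟨F, le_top, ?_, fun x hx => ?_⟩
  swap
  · have := hF x hx
    rw [_root_.neg_apply, inner_neg_right, Complex.neg_re] at this
    linarith
  -- Otherwise `W` has codimension at most `m`, so its hull contains `c`; yet positivity on `W` puts
  -- that hull in a half-plane missing `c` by a margin `ε`.
  by_contra hk
  have hcW := Set.mem_iInter.1 hc ⟨W, by omega⟩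
  obtain ⟨ε, hε, hW⟩ := exists_pos_mul_norm_sq_le W _ hW
  have hsub : closure (convexHull ℝ (numericalValues T W)) ⊆
      {w : ℂ | (z * w).re ≤ (z * c).re - ε} := by
    refine closure_minimal (convexHull_min ?_ ?_) ?_
    · rintro _ ⟨x, ⟨hx, hx1⟩, rfl⟩
      have h1 := hW x hx
      rw [_root_.neg_apply, inner_neg_right, inner_smul_sub_smul_one, hx1, mul_sub] at h1
      simp only [Complex.ofReal_one, one_pow, mul_one, Complex.neg_re, Complex.sub_re] at h1
      simp only [Set.mem_ofPred_eq]
      linarith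
    · exact convex_halfSpace_le
        ⟨fun a b => by rw [mul_add, Complex.add_re],
          fun r a => by simp [Complex.mul_re]; ring⟩ _
    · exact isClosed_le (by fun_prop) continuous_const
  have : (z * c).re ≤ (z * c).re - ε := hsub hcW
  linarith

/-- The higher rank numerical range of rank `m + 1` is nonempty in dimension above `3 * m`. -/
theorem exists_subspace_inner_eq (T : V →L[ℂ] V) {m : ℕ} (h : 3 * m < finrank ℂ V) :
    ∃ (c : ℂ) (E : Submodule ℂ V), finrank ℂ E = m + 1 ∧
      ∀ x ∈ E, inner ℂ x (T x) = c * ‖x‖ ^ 2 := by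
  obtain ⟨c, hc⟩ := exists_weakDim_sub_smul_one T h
  obtain ⟨E, -, hE, hi⟩ := hc.exists_isotropicOn
  exact ⟨c, E, hE, isotropicOn_sub_smul_one_iff.1 hi⟩

end NumericalRange

/-! ### Operator systems of dimension at most three. -/

section OperatorSystems

open Module ComplexConjugate

variable {n : ℕ} {V : Submodule ℂ (Matrix (Fin n) (Fin n) ℂ)}

theorem IsOperatorSystem.exists_isHermitian_notMem (hV : IsOperatorSystem V)
    {S : Submodule ℂ (Matrix (Fin n) (Fin n) ℂ)} (h : ¬ V ≤ S) :
    ∃ A ∈ V, A.IsHermitian ∧ A ∉ S := by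
  by_contra! hS
  refine h fun X hX => ?_
  have hX' := hV.conjTranspose_mem X hX
  have h1 := hS (X + Xᴴ) (V.add_mem hX hX') (by simp [Matrix.IsHermitian, add_comm])
  have h2 := hS (Complex.I • (X - Xᴴ)) (V.smul_mem _ (V.sub_mem hX hX')) (by
    simp [Matrix.IsHermitian, sub_eq_neg_add, add_comm])
  have h3 : X = (1 / 2 : ℂ) • (X + Xᴴ) + (-Complex.I / 2) • (Complex.I • (X - Xᴴ)) := by
    rw [smul_smul, show -Complex.I / 2 * Complex.I = 1 / 2 by
      rw [div_mul_eq_mul_div, neg_mul, Complex.I_mul_I, neg_neg]]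
    module
  rw [h3]
  exact S.add_mem (S.smul_mem _ h1) (S.smul_mem _ h2)

/-- An operator system of dimension at most three is spanned by the identity, some matrix and its
adjoint. -/
theorem IsOperatorSystem.exists_le_span (hV : IsOperatorSystem V) (hn : 0 < n)
    (h3 : finrank ℂ V ≤ 3) : ∃ T : Matrix (Fin n) (Fin n) ℂ, V ≤ Submodule.span ℂ {1, T, Tᴴ} := by
  by_cases h₁ : V ≤ Submodule.span ℂ {1}
  · exact ⟨0, h₁.trans (Submodule.span_mono (by simp))⟩
  obtain ⟨A, hA, hAh, hA₁⟩ := hV.exists_isHermitian_notMem h₁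
  by_cases h₂ : V ≤ Submodule.span ℂ {1, A}
  · exact ⟨A, h₂.trans (Submodule.span_mono (by simp [Set.insert_subset_iff]))⟩
  obtain ⟨B, hB, hBh, hB₂⟩ := hV.exists_isHermitian_notMem h₂
  have hlt₁ : Submodule.span ℂ {(1 : Matrix (Fin n) (Fin n) ℂ)} < Submodule.span ℂ {1, A} :=
    lt_of_le_of_ne (Submodule.span_mono (by simp)) fun h =>
      hA₁ (h ▸ Submodule.subset_span (by simp))
  have hlt₂ : Submodule.span ℂ {(1 : Matrix (Fin n) (Fin n) ℂ), A} <
      Submodule.span ℂ {1, A, B} :=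
    lt_of_le_of_ne (Submodule.span_mono (by simp [Set.insert_subset_iff])) fun h =>
      hB₂ (h ▸ Submodule.subset_span (by simp))
  have hle : Submodule.span ℂ {(1 : Matrix (Fin n) (Fin n) ℂ), A, B} ≤ V := by
    rw [Submodule.span_le]
    simp [Set.insert_subset_iff, hA, hB, hV.one_mem]
  have : NeZero n := ⟨hn.ne'⟩
  have hf₀ : finrank ℂ (Submodule.span ℂ {(1 : Matrix (Fin n) (Fin n) ℂ)}) = 1 :=
    finrank_span_singleton one_ne_zero
  have hf₁ := Submodule.finrank_lt_finrank_of_lt hlt₁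
  have hf₂ := Submodule.finrank_lt_finrank_of_lt hlt₂
  have heq := Submodule.eq_of_le_of_finrank_le hle (by omega)
  refine ⟨A + Complex.I • B, ?_⟩
  rw [← heq, Submodule.span_le]
  set T := A + Complex.I • B with hT
  have hTh : Tᴴ = A - Complex.I • B := by
    rw [hT, Matrix.conjTranspose_add, Matrix.conjTranspose_smul, hAh.eq, hBh.eq]
    simp [sub_eq_add_neg]
  have m₁ : T ∈ Submodule.span ℂ {1, T, Tᴴ} := Submodule.subset_span (by simp)
  have m₂ : Tᴴ ∈ Submodule.span ℂ {1, T, Tᴴ} := Submodule.subset_span (by simp)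
  have eA : A = (1 / 2 : ℂ) • T + (1 / 2 : ℂ) • Tᴴ := by
    rw [hTh, hT]
    module
  have eB : B = (-Complex.I / 2) • T + (Complex.I / 2) • Tᴴ := by
    rw [hTh, hT, smul_add, smul_sub, smul_smul, smul_smul, div_mul_eq_mul_div,
      div_mul_eq_mul_div, neg_mul, Complex.I_mul_I]
    module
  rintro X (rfl | rfl | rfl)
  · exact Submodule.subset_span (by simp)
  · rw [SetLike.mem_coe, eA]
    exact Submodule.add_mem _ (Submodule.smul_mem _ _ m₁) (Submodule.smul_mem _ _ m₂)
  · rw [SetLike.mem_coe, eB]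
    exact Submodule.add_mem _ (Submodule.smul_mem _ _ m₁) (Submodule.smul_mem _ _ m₂)

theorem rank_toEuclideanCLM_symm_starProjection
    (E : Submodule ℂ (EuclideanSpace ℂ (Fin n))) :
    (Matrix.toEuclideanCLM (n := Fin n) (𝕜 := ℂ) |>.symm E.starProjection).rank = finrank ℂ E := by
  set P := (Matrix.toEuclideanCLM (n := Fin n) (𝕜 := ℂ)).symm E.starProjection with hP
  have h1 : Matrix.toEuclideanCLM (n := Fin n) (𝕜 := ℂ) P = E.starProjection := by simp [hP]
  have h2 : (Matrix.toEuclideanLin P : EuclideanSpace ℂ (Fin n) →ₗ[ℂ] _) =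
      (E.starProjection : EuclideanSpace ℂ (Fin n) →ₗ[ℂ] _) := by
    rw [← h1]
    rfl
  rw [Matrix.rank_eq_finrank_range_toLin P (EuclideanSpace.basisFun (Fin n) ℂ).toBasis
    (EuclideanSpace.basisFun (Fin n) ℂ).toBasis, ← Matrix.toEuclideanLin_eq_toLin_orthonormal, h2]
  rw [E.range_starProjection]

theorem IsOperatorSystem.exists_isAnticlique (hV : IsOperatorSystem V) {m : ℕ} (hm : 3 * m < n)
    (h3 : finrank ℂ V ≤ 3) : ∃ P, IsAnticlique V (m + 1) P := by
  obtain ⟨T, hT⟩ := hV.exists_le_span (by omega) h3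
  set Φ := Matrix.toEuclideanCLM (n := Fin n) (𝕜 := ℂ) with hΦ
  obtain ⟨c, E, hE, hc⟩ := exists_subspace_inner_eq (Φ T) (m := m) (by simpa using hm)
  set P := Φ.symm E.starProjection with hP
  have hΦP : Φ P = E.starProjection := by simp [hP]
  have hherm : Pᴴ = P := by
    apply EquivLike.injective Φ
    rw [← Matrix.star_eq_conjTranspose, map_star, hΦP]
    exact (isSelfAdjoint_starProjection E).star_eq
  have hidem : P * P = P := by
    apply EquivLike.injective Φ
    rw [map_mul, hΦP]
    exact E.isIdempotentElem_starProjection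
  have hPT : P * T * P = c • P := by
    apply EquivLike.injective Φ
    rw [map_mul, map_mul, map_smul, hΦP]
    apply ContinuousLinearMap.coe_injective
    -- Over `ℂ` an operator is determined by its quadratic form, so constancy on `E` gives the whole
    -- compression.
    rw [← ext_inner_map]
    intro x
    have h1 := congrArg conj (hc (E.starProjection x) (E.starProjection_apply_mem x))
    have h2 : inner ℂ (E.starProjection x) x = (‖E.starProjection x‖ : ℂ) ^ 2 := by
      conv_lhs => rw [← E.starProjection_eq_self_iff.2 (E.starProjection_apply_mem x)]
      rw [E.inner_starProjection_left_eq_right]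
      exact inner_self_eq_norm_sq_to_K _
    rw [inner_conj_symm, map_mul, map_pow, Complex.conj_ofReal, ← h2] at h1
    calc inner ℂ (E.starProjection (Φ T (E.starProjection x))) x
        = inner ℂ (Φ T (E.starProjection x)) (E.starProjection x) :=
          E.inner_starProjection_left_eq_right _ _
      _ = inner ℂ (c • E.starProjection x) x := by rw [h1, inner_smul_left]
  have hPT' : P * Tᴴ * P = conj c • P := by
    have := congrArg Matrix.conjTranspose hPT
    rw [Matrix.conjTranspose_mul, Matrix.conjTranspose_mul, Matrix.conjTranspose_smul, hherm,
      ← mul_assoc] at this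
    exact this
  refine ⟨P, hherm, hidem, (rank_toEuclideanCLM_symm_starProjection E).trans hE, ?_⟩
  ext X
  constructor
  · rintro ⟨A, hA, rfl⟩
    have : Submodule.span ℂ {1, T, Tᴴ} ≤ (Submodule.span ℂ {P}).comap
        (LinearMap.mulRight ℂ P ∘ₗ LinearMap.mulLeft ℂ P) := by
      rw [Submodule.span_le]
      rintro X (rfl | rfl | rfl)
      · simp [hidem]
      · simpa [hPT] using Submodule.smul_mem _ _ (Submodule.mem_span_singleton_self P)
      · simpa [hPT'] using Submodule.smul_mem _ _ (Submodule.mem_span_singleton_self P)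
    simpa using this (hT hA)
  · intro hX
    obtain ⟨r, rfl⟩ := Submodule.mem_span_singleton.1 hX
    exact ⟨r • 1, V.smul_mem _ hV.one_mem, by simp [hidem]⟩

/-! ### The four-dimensional diagonal example. -/

/-- The projection onto the coordinates congruent to `j` modulo four. -/
def residueProjection (n : ℕ) (j : Fin 4) : Matrix (Fin n) (Fin n) ℂ :=
  Matrix.diagonal fun i => if (i : ℕ) % 4 = j then 1 else 0

theorem sum_residueProjection (n : ℕ) : ∑ j, residueProjection n j = 1 := by
  rw [← Matrix.diagonal_one]
  ext i k
  rw [Matrix.sum_apply]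
  by_cases hik : i = k
  · subst hik
    simp only [residueProjection, Matrix.diagonal_apply_eq]
    rw [Finset.sum_eq_single (⟨i % 4, Nat.mod_lt _ (by norm_num)⟩ : Fin 4)]
    · simp
    · intro j _ hj
      exact if_neg fun h => hj (Fin.ext h.symm)
    · simp
  · simp [residueProjection, hik]

theorem rank_residueProjection_le {m : ℕ} (hn : n ≤ 4 * m) (j : Fin 4) :
    (residueProjection n j).rank ≤ m := by
  rw [residueProjection, Matrix.rank_diagonal]
  refine (Fintype.card_le_of_injective
    (fun i => (⟨i.1 / 4, by have := i.1.2; omega⟩ : Fin m)) ?_).trans (Fintype.card_fin m).le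
  rintro ⟨a, ha⟩ ⟨b, hb⟩ hab
  simp only [ne_eq, ite_eq_right_iff, one_ne_zero, imp_false, not_not] at ha hb
  simp only [Fin.mk.injEq] at hab
  exact Subtype.ext (Fin.ext (by simp only; omega))

theorem linearIndependent_residueProjection (hn : 4 ≤ n) :
    LinearIndependent ℂ (residueProjection n) := by
  rw [Fintype.linearIndependent_iff]
  intro g hg j
  have hj : (j : ℕ) < n := j.2.trans_le hn
  have h := congrFun (congrFun hg ⟨j, hj⟩) ⟨j, hj⟩
  rw [Matrix.sum_apply, Finset.sum_eq_single j] at h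
  · simpa [residueProjection, Nat.mod_eq_of_lt j.2] using h
  · intro k _ hk
    have : (j : ℕ) ≠ k := fun h => hk (Fin.ext h.symm)
    simp [residueProjection, Nat.mod_eq_of_lt j.2, this]
  · simp

theorem isOperatorSystem_span_residueProjection (n : ℕ) :
    IsOperatorSystem (Submodule.span ℂ (Set.range (residueProjection n))) where
  one_mem := by
    rw [← sum_residueProjection]
    exact Submodule.sum_mem _ fun j _ => Submodule.subset_span ⟨j, rfl⟩
  conjTranspose_mem A hA := by
    induction hA using Submodule.span_induction with
    | mem x hx =>
      obtain ⟨j, rfl⟩ := hx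
      have : (residueProjection n j)ᴴ = residueProjection n j := by
        rw [residueProjection, Matrix.diagonal_conjTranspose]
        congr 1
        ext i
        simp only [Pi.star_apply]
        split_ifs <;> simp
      rw [this]
      exact Submodule.subset_span ⟨j, rfl⟩
    | zero => simp
    | add x y _ _ hx hy => simpa using Submodule.add_mem _ hx hy
    | smul a x _ hx => simpa using Submodule.smul_mem _ _ hx

theorem not_exists_isAnticlique_span_residueProjection {m : ℕ} (hn : n ≤ 4 * m) :
    ¬ ∃ P, IsAnticlique (Submodule.span ℂ (Set.range (residueProjection n))) (m + 1) P := by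
  rintro ⟨P, hP⟩
  have hzero : ∀ j, P * residueProjection n j * P = 0 := by
    intro j
    have h1 : P * residueProjection n j * P ∈ (Submodule.span ℂ {P} : Set _) := by
      rw [← hP.compression_eq]
      exact ⟨_, Submodule.subset_span ⟨j, rfl⟩, rfl⟩
    obtain ⟨r, hr⟩ := Submodule.mem_span_singleton.1 h1
    rcases eq_or_ne r 0 with rfl | h0
    · rw [← hr, zero_smul]
    exfalso
    -- A nonzero multiple would factor `P`, of rank `m + 1`, through a matrix of rank at most `m`.
    have h2 : P = (r⁻¹ • P) * residueProjection n j * P := by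
      rw [smul_mul_assoc, smul_mul_assoc, ← hr, inv_smul_smul₀ h0]
    have h3 := congrArg Matrix.rank h2
    have h4 := (Matrix.rank_mul_le_left ((r⁻¹ • P) * residueProjection n j) P).trans
      (Matrix.rank_mul_le_right (r⁻¹ • P) (residueProjection n j))
    have h5 := rank_residueProjection_le hn j
    have h6 := hP.rank_eq
    omega
  have hP0 : P = 0 := by
    have h : P * 1 * P = P := by rw [mul_one, hP.idempotent]
    rw [← h, ← sum_residueProjection, Finset.mul_sum, Finset.sum_mul]
    exact Finset.sum_eq_zero fun j _ => hzero j
  have := hP.rank_eq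
  simp [hP0] at this

theorem isLeast_lowerTuranDims {n m : ℕ} (hm : 3 * m < n) (hn : n ≤ 4 * m) :
    IsLeast (lowerTuranDims n m) 4 := by
  refine ⟨⟨_, isOperatorSystem_span_residueProjection n, ?_,
    not_exists_isAnticlique_span_residueProjection hn⟩, ?_⟩
  -- The two inequalities force `m ≥ 1`, hence `n ≥ 4`, so all four residues occur.
  · rw [finrank_span_eq_card (linearIndependent_residueProjection (by omega)), Fintype.card_fin]
  · rintro d ⟨V, hV, rfl, hno⟩
    by_contra h
    exact hno (hV.exists_isAnticlique hm (by omega))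

end OperatorSystems

theorem mainTheorem2 :
    (∀ n m : ℕ, 3 * m < n → n ≤ 4 * m →
      lowerQuantumTuran n m = 4 ∧ IsLeast (lowerTuranDims n m) 4) ∧
    lowerQuantumTuran 4 1 = 4 :=
  ⟨fun _ _ hm hn => ⟨(isLeast_lowerTuranDims hm hn).csInf_eq, isLeast_lowerTuranDims hm hn⟩,
    (isLeast_lowerTuranDims (by norm_num) (by norm_num)).csInf_eq⟩
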